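/- Let $G\rightrightarrows M$ be a proper étale Lie groupoid over smooth (Hausdorff, second countable, finite-dimensional) manifolds, with source and target maps $s,t$, presenting the orbifold $X=M/G$ with orbit projection $\pi\colon M\to X$. A (piecewise smooth) $G$-path is a sequence $\sigma=\sigma_k g_k\sigma_{k-1}\cdots g_1\sigma_0$ of piecewise smooth paths $\sigma_j\colon[0,1]\to M$ and arrows $g_j\in G$ from $\sigma_{j-1}(1)$ to $\sigma_j(0)$; it is a $G$-loop at $x_0$ if $\sigma_0(0)=\sigma_k(1)=x_0$. Assume that $G$ is $G$-connected, i.e. any two points of $M$ are joined by a $G$-path. Let $Y\subset X$ be a closed subset and $N=\pi^{-1}(Y)$. Let $\omega$ be a closed basic 1-form on $M$ (that is, $d\omega=0$ and $s^*\omega=t^*\omega$), and let $\xi=[\omega]\in H^1_{\mathrm{bas}}(G,\mathbb R)$ be its basic cohomology class (closed basic 1-forms modulo differentials of smooth basic functions, i.e. smooth $f\colon M\to\mathbb R$ with $f\circ s=f\circ t$). Suppose that $\xi$ is integral, i.e. its periods $\mathrm{Per}_\xi([\sigma])=\int_\sigma\omega=\sum_{j}\int_{\sigma_j}\omega$ over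 $G$-loops $\sigma$ are all integers. Then the following two conditions are equivalent: (2) there are an open neighborhood $\tilde U$ of $Y$ in $X$ and a smooth function $\overline f\colon\tilde U\to\mathbb R$ (i.e. $f=\overline f\circ\pi$ is smooth on $\pi^{-1}(\tilde U)$) such that $\omega|_{\pi^{-1}(\tilde U)}=df$ and $df$ vanishes at every point of $N$; (2') $\omega$, viewed as a section of $T^*M$, vanishes at every point of $N$. -/

import Mathlib

open Set
open scoped Manifold ContDiff

/-! ### Lie groupoids -/

/-- A Lie groupoid `G ⇉ M` over smooth manifolds. The multiplication `mul g h` (first `h`, then `g`)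
is meaningful for composable pairs `src g = tgt h` only; its values at other pairs are irrelevant:
the axioms and the smoothness requirement only concern the fibre product. -/
structure LieGroupoid (n m : ℕ) (M G : Type*)
    [TopologicalSpace M] [ChartedSpace (EuclideanSpace ℝ (Fin n)) M]
    [TopologicalSpace G] [ChartedSpace (EuclideanSpace ℝ (Fin m)) G] where
  src : G → M
  tgt : G → M
  mul : G → G → G
  one : M → G
  inv : G → G
  src_one : ∀ x, src (one x) = x
  tgt_one : ∀ x, tgt (one x) = x
  src_mul : ∀ g h, src g = tgt h → src (mul g h) = src h
  tgt_mul : ∀ g h, src g = tgt h → tgt (mul g h) = tgt g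
  src_inv : ∀ g, src (inv g) = tgt g
  tgt_inv : ∀ g, tgt (inv g) = src g
  mul_assoc : ∀ g h k, src g = tgt h → src h = tgt k → mul (mul g h) k = mul g (mul h k)
  one_mul : ∀ g, mul (one (tgt g)) g = g
  mul_one : ∀ g, mul g (one (src g)) = g
  inv_mul : ∀ g, mul (inv g) g = one (src g)
  mul_inv : ∀ g, mul g (inv g) = one (tgt g)
  contMDiff_src : ContMDiff (𝓡 m) (𝓡 n) ∞ src
  contMDiff_tgt : ContMDiff (𝓡 m) (𝓡 n) ∞ tgt
  submersion_src : ∀ g, Function.Surjective (mfderiv (𝓡 m) (𝓡 n) src g)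
  submersion_tgt : ∀ g, Function.Surjective (mfderiv (𝓡 m) (𝓡 n) tgt g)
  contMDiff_one : ContMDiff (𝓡 n) (𝓡 m) ∞ one
  contMDiff_inv : ContMDiff (𝓡 m) (𝓡 m) ∞ inv
  contMDiffOn_mul : ContMDiffOn ((𝓡 m).prod (𝓡 m)) (𝓡 m) ∞
    (fun p : G × G => mul p.1 p.2) {p : G × G | src p.1 = tgt p.2}

section Groupoid

variable {n m : ℕ} {M G : Type*}
  [TopologicalSpace M] [ChartedSpace (EuclideanSpace ℝ (Fin n)) M]
  [TopologicalSpace G] [ChartedSpace (EuclideanSpace ℝ (Fin m)) G]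

namespace LieGroupoid

/-- The map `(s, t) : G → M × M` is proper. -/
def IsProper (𝒢 : LieGroupoid n m M G) : Prop :=
  IsProperMap (fun g => (𝒢.src g, 𝒢.tgt g))

/-- Either `s` or `t` is a local diffeomorphism. -/
def IsEtale (𝒢 : LieGroupoid n m M G) : Prop :=
  IsLocalDiffeomorph (𝓡 m) (𝓡 n) ∞ 𝒢.src ∨ IsLocalDiffeomorph (𝓡 m) (𝓡 n) ∞ 𝒢.tgt

/-- Two points of `M` are equivalent if they are joined by an arrow. -/
def orbitSetoid (𝒢 : LieGroupoid n m M G) : Setoid M where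
  r x y := ∃ g, 𝒢.src g = x ∧ 𝒢.tgt g = y
  iseqv :=
    { refl := fun x => ⟨𝒢.one x, 𝒢.src_one x, 𝒢.tgt_one x⟩
      symm := by
        rintro x y ⟨g, rfl, rfl⟩
        exact ⟨𝒢.inv g, 𝒢.src_inv g, 𝒢.tgt_inv g⟩
      trans := by
        rintro x y z ⟨g, rfl, rfl⟩ ⟨h, hs, rfl⟩
        exact ⟨𝒢.mul h g, 𝒢.src_mul h g hs, 𝒢.tgt_mul h g hs⟩ }

/-- The orbit space `X = M / G`, with the quotient topology. -/
def OrbitSpace (𝒢 : LieGroupoid n m M G) : Type _ := Quotient 𝒢.orbitSetoid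

instance (𝒢 : LieGroupoid n m M G) : TopologicalSpace 𝒢.OrbitSpace :=
  inferInstanceAs (TopologicalSpace (Quotient 𝒢.orbitSetoid))

/-- The orbit projection `π : M → X`. -/
def proj (𝒢 : LieGroupoid n m M G) (x : M) : 𝒢.OrbitSpace := Quotient.mk 𝒢.orbitSetoid x

end LieGroupoid

/-! ### `G`-paths -/

/-- `γ` restricts to a piecewise smooth path `[0, 1] → M`; its values outside `[0, 1]` are
irrelevant. -/
def IsPiecewiseSmooth (n : ℕ) {M : Type*} [TopologicalSpace M]
    [ChartedSpace (EuclideanSpace ℝ (Fin n)) M] (γ : ℝ → M) : Prop :=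
  ∃ (k : ℕ) (t : ℕ → ℝ), Monotone t ∧ t 0 = 0 ∧ t k = 1 ∧
    ∀ i < k, ContMDiffOn 𝓘(ℝ, ℝ) (𝓡 n) ∞ γ (Icc (t i) (t (i + 1)))

/-- A (piecewise smooth) `G`-path `σₙ gₙ σₙ₋₁ ⋯ σ₁ g₁ σ₀` with `gⱼ` an arrow from `σⱼ₋₁(1)` to
`σⱼ(0)`. -/
structure GPath (𝒢 : LieGroupoid n m M G) where
  order : ℕ
  path : Fin (order + 1) → ℝ → M
  arrow : Fin order → G
  piecewiseSmooth : ∀ j, IsPiecewiseSmooth n (path j)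
  src_arrow : ∀ j, 𝒢.src (arrow j) = path j.castSucc 1
  tgt_arrow : ∀ j, 𝒢.tgt (arrow j) = path j.succ 0

namespace GPath

variable {𝒢 : LieGroupoid n m M G}

/-- The initial point `σ₀(0)`. -/
def start (σ : GPath 𝒢) : M := σ.path 0 0

/-- The final point `σₙ(1)`. -/
def finish (σ : GPath 𝒢) : M := σ.path (Fin.last σ.order) 1

end GPath

/-- Any two points of `M` are joined by a `G`-path. -/
def LieGroupoid.IsGConnected (𝒢 : LieGroupoid n m M G) : Prop :=
  ∀ x y : M, ∃ σ : GPath 𝒢, σ.start = x ∧ σ.finish = y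

/-- The `G`-loops at `x₀`. -/
def GLoop (𝒢 : LieGroupoid n m M G) (x₀ : M) : Type _ :=
  {σ : GPath 𝒢 // σ.start = x₀ ∧ σ.finish = x₀}

end Groupoid

/-! ### Differential 1-forms on a manifold -/

section Forms

variable {n : ℕ} {M : Type*} [TopologicalSpace M] [ChartedSpace (EuclideanSpace ℝ (Fin n)) M]

/-- The differential `df` of a function `f : M → ℝ` at a point. -/
noncomputable def dFun (n : ℕ) {M : Type*} [TopologicalSpace M]
    [ChartedSpace (EuclideanSpace ℝ (Fin n)) M] (f : M → ℝ) (x : M) :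
    TangentSpace (𝓡 n) x →L[ℝ] ℝ :=
  mfderiv (𝓡 n) 𝓘(ℝ, ℝ) f x

/-- A smooth 1-form, i.e. a smooth section of the cotangent bundle of `M`. -/
structure OneForm (n : ℕ) (M : Type*) [TopologicalSpace M]
    [ChartedSpace (EuclideanSpace ℝ (Fin n)) M] [IsManifold (𝓡 n) ∞ M] where
  toFun : ∀ x : M, TangentSpace (𝓡 n) x →L[ℝ] ℝ
  smooth : ContMDiff (𝓡 n) ((𝓡 n).prod 𝓘(ℝ, EuclideanSpace ℝ (Fin n) →L[ℝ] ℝ)) ∞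
    (fun x => Bundle.TotalSpace.mk' (EuclideanSpace ℝ (Fin n) →L[ℝ] ℝ)
      (E := fun x : M => TangentSpace (𝓡 n) x →L[ℝ] ℝ) x (toFun x))

variable [IsManifold (𝓡 n) ∞ M]

/-- The local representation `(φ⁻¹)^* θ` of a 1-form in the preferred chart `φ` at `x₀`. -/
noncomputable def OneForm.inChart (θ : OneForm n M) (x₀ : M) (y : EuclideanSpace ℝ (Fin n)) :
    EuclideanSpace ℝ (Fin n) →L[ℝ] ℝ :=
  (θ.toFun ((extChartAt (𝓡 n) x₀).symm y)).comp
    (mfderiv 𝓘(ℝ, EuclideanSpace ℝ (Fin n)) (𝓡 n) (extChartAt (𝓡 n) x₀).symm y)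

/-- `dθ = 0`: in each chart, the local representation `η` of `θ` satisfies
`dη(u, v) = (D_u η)(v) - (D_v η)(u) = 0`. -/
def OneForm.IsClosed (θ : OneForm n M) : Prop :=
  ∀ x₀ : M, ∀ y ∈ (extChartAt (𝓡 n) x₀).target, ∀ u v : EuclideanSpace ℝ (Fin n),
    fderiv ℝ (θ.inChart x₀) y u v - fderiv ℝ (θ.inChart x₀) y v u = 0

/-- The integrand `θ(γ(t))(γ'(t))`. -/
noncomputable def OneForm.pathIntegrand (θ : OneForm n M) (γ : ℝ → M) (t : ℝ) : ℝ :=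
  θ.toFun (γ t) ((mfderiv 𝓘(ℝ, ℝ) (𝓡 n) γ t : ℝ →L[ℝ] TangentSpace (𝓡 n) (γ t)) 1)

/-- The integral `∫_γ θ = ∫₀¹ θ(γ(t))(γ'(t)) dt` along a piecewise smooth path. -/
noncomputable def OneForm.pathIntegral (θ : OneForm n M) (γ : ℝ → M) : ℝ :=
  ∫ t in (0 : ℝ)..1, θ.pathIntegrand γ t

theorem OneForm.intervalIntegrable_piece (θ : OneForm n M) {γ : ℝ → M} {a b : ℝ} (hab : a ≤ b)
    (hγ : ContMDiffOn 𝓘(ℝ, ℝ) (𝓡 n) ∞ γ (Icc a b)) :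
    IntervalIntegrable (θ.pathIntegrand γ) MeasureTheory.volume a b := by
  rcases hab.eq_or_lt with rfl | hab'
  · simp
  have hu : UniqueMDiffOn 𝓘(ℝ, ℝ) (Icc a b) := (uniqueDiffOn_Icc hab').uniqueMDiffOn
  have h1 : ContMDiffOn 𝓘(ℝ, ℝ) (𝓡 n).tangent 0
      (fun t : ℝ => (⟨γ t, (mfderivWithin 𝓘(ℝ, ℝ) (𝓡 n) γ (Icc a b) t :
        ℝ →L[ℝ] TangentSpace (𝓡 n) (γ t)) 1⟩ : TangentBundle (𝓡 n) M)) (Icc a b) := by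
    have h := hγ.contMDiffOn_tangentMapWithin (m := 0) (by simp) hu
    have hs : ContMDiffOn 𝓘(ℝ, ℝ) 𝓘(ℝ, ℝ).tangent 0
        (fun t : ℝ => (⟨t, (1 : ℝ)⟩ : TangentBundle 𝓘(ℝ, ℝ) ℝ)) (Icc a b) :=
      contMDiffOn_vectorSpace_iff_contDiffOn.2 contDiffOn_const
    exact h.comp hs (fun t ht => ht)
  have h2 : ContMDiffOn 𝓘(ℝ, ℝ) ((𝓡 n).prod 𝓘(ℝ, EuclideanSpace ℝ (Fin n) →L[ℝ] ℝ)) 0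
      (fun t : ℝ => Bundle.TotalSpace.mk' (EuclideanSpace ℝ (Fin n) →L[ℝ] ℝ)
        (E := fun x : M => TangentSpace (𝓡 n) x →L[ℝ] ℝ) (γ t) (θ.toFun (γ t))) (Icc a b) :=
    (θ.smooth.comp_contMDiffOn hγ).of_le (by simp)
  have h3 : ContMDiffOn 𝓘(ℝ, ℝ) ((𝓡 n).prod 𝓘(ℝ, ℝ)) 0
      (fun t : ℝ => Bundle.TotalSpace.mk' ℝ (E := Bundle.Trivial M ℝ) (γ t)
        (θ.toFun (γ t) ((mfderivWithin 𝓘(ℝ, ℝ) (𝓡 n) γ (Icc a b) t :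
          ℝ →L[ℝ] TangentSpace (𝓡 n) (γ t)) 1))) (Icc a b) :=
    ContMDiffOn.clm_bundle_apply (E₁ := fun x : M => TangentSpace (𝓡 n) x)
      (E₂ := Bundle.Trivial M ℝ) (F₁ := EuclideanSpace ℝ (Fin n)) (F₂ := ℝ) h2 h1
  have h4 : ContinuousOn (fun t : ℝ => θ.toFun (γ t)
      ((mfderivWithin 𝓘(ℝ, ℝ) (𝓡 n) γ (Icc a b) t :
          ℝ →L[ℝ] TangentSpace (𝓡 n) (γ t)) 1)) (Icc a b) := by
    intro t ht
    have h5 := h3 t ht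
    simp only [Bundle.contMDiffWithinAt_totalSpace] at h5
    exact h5.2.continuousWithinAt
  have h5 := h4.intervalIntegrable_of_Icc hab (μ := MeasureTheory.volume)
  refine h5.congr_uIoo fun t ht => ?_
  rw [uIoo_of_le hab] at ht
  simp only [OneForm.pathIntegrand]
  rw [mfderivWithin_of_mem_nhds (Icc_mem_nhds ht.1 ht.2)]

theorem OneForm.intervalIntegrable (θ : OneForm n M) {γ : ℝ → M} (hγ : IsPiecewiseSmooth n γ) :
    IntervalIntegrable (θ.pathIntegrand γ) MeasureTheory.volume 0 1 := by
  obtain ⟨k, t, ht, h0, h1, h⟩ := hγ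
  rw [← h0, ← h1]
  exact IntervalIntegrable.trans_iterate fun i hi =>
    θ.intervalIntegrable_piece (ht i.le_succ) (h i hi)

/-- If two 1-forms differ by `df`, their integrals along a path differ by the increment of `f`. -/
theorem OneForm.pathIntegral_sub (θ θ' : OneForm n M) {f : M → ℝ}
    (hf : ContMDiff (𝓡 n) 𝓘(ℝ, ℝ) ∞ f) (hd : ∀ x, θ.toFun x - θ'.toFun x = dFun n f x)
    {γ : ℝ → M} (hγ : IsPiecewiseSmooth n γ) :
    θ.pathIntegral γ - θ'.pathIntegral γ = f (γ 1) - f (γ 0) := by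
  have hi := θ.intervalIntegrable hγ
  have hi' := θ'.intervalIntegrable hγ
  obtain ⟨k, t, ht, h0, h1, h⟩ := hγ
  rw [OneForm.pathIntegral, OneForm.pathIntegral, ← intervalIntegral.integral_sub hi hi']
  have hp : ∀ i < k, IntervalIntegrable
      (fun s => θ.pathIntegrand γ s - θ'.pathIntegrand γ s) MeasureTheory.volume
      (t i) (t (i + 1)) := fun i hi =>
    (θ.intervalIntegrable_piece (ht i.le_succ) (h i hi)).sub
      (θ'.intervalIntegrable_piece (ht i.le_succ) (h i hi))
  rw [← h0, ← h1, ← intervalIntegral.sum_integral_adjacent_intervals hp,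
    ← Finset.sum_range_sub (fun i => f (γ (t i)))]
  refine Finset.sum_congr rfl fun i hi => ?_
  have hi := Finset.mem_range.1 hi
  refine intervalIntegral.integral_eq_sub_of_hasDerivAt_of_le (f := fun s => f (γ s))
    (ht i.le_succ) (hf.continuous.comp_continuousOn (h i hi).continuousOn) ?_ (hp i hi)
  intro s hs
  have hγs : MDifferentiableAt 𝓘(ℝ, ℝ) (𝓡 n) γ s :=
    ((h i hi).contMDiffAt (Icc_mem_nhds hs.1 hs.2)).mdifferentiableAt (by simp)
  have hfs : MDifferentiableAt (𝓡 n) 𝓘(ℝ, ℝ) f (γ s) :=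
    hf.contMDiffAt.mdifferentiableAt (by simp)
  obtain ⟨L, hL⟩ : ∃ L : ℝ →L[ℝ] ℝ, L = (mfderiv (𝓡 n) 𝓘(ℝ, ℝ) f (γ s)).comp
      (mfderiv 𝓘(ℝ, ℝ) (𝓡 n) γ s) := ⟨_, rfl⟩
  have hc : HasFDerivAt (fun s => f (γ s)) L s := by
    rw [hL]
    exact (hfs.hasMFDerivAt.comp s hγs.hasMFDerivAt).hasFDerivAt
  refine hc.hasDerivAt.congr_deriv ?_
  rw [hL]
  exact (congrArg (fun L => L ((mfderiv 𝓘(ℝ, ℝ) (𝓡 n) γ s :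
    ℝ →L[ℝ] TangentSpace (𝓡 n) (γ s)) 1)) (hd (γ s))).symm

/-- The vanishing of a 1-form, as a section of `T*M`, at each point of a set. -/
def OneForm.VanishesOn (θ : OneForm n M) (N : Set M) : Prop :=
  ∀ x ∈ N, θ.toFun x = 0

end Forms

/-! ### Basic forms, basic cohomology in degree one, and periods -/

section Basic

variable {n m : ℕ} {M G : Type*}
  [TopologicalSpace M] [ChartedSpace (EuclideanSpace ℝ (Fin n)) M] [IsManifold (𝓡 n) ∞ M]
  [TopologicalSpace G] [ChartedSpace (EuclideanSpace ℝ (Fin m)) G]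

/-- `t^* ω = s^* ω`. -/
def OneForm.IsBasic (𝒢 : LieGroupoid n m M G) (θ : OneForm n M) : Prop :=
  ∀ g : G, (θ.toFun (𝒢.tgt g)).comp (mfderiv (𝓡 m) (𝓡 n) 𝒢.tgt g) =
    (θ.toFun (𝒢.src g)).comp (mfderiv (𝓡 m) (𝓡 n) 𝒢.src g)

/-- Closed basic 1-forms on `M`, that is, closed 1-forms on the orbit space. -/
def ClosedBasicOneForm (𝒢 : LieGroupoid n m M G) : Type _ :=
  {θ : OneForm n M // θ.IsBasic 𝒢 ∧ θ.IsClosed}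

/-- Smooth basic functions on `M`. -/
def IsSmoothBasic (𝒢 : LieGroupoid n m M G) (f : M → ℝ) : Prop :=
  ContMDiff (𝓡 n) 𝓘(ℝ, ℝ) ∞ f ∧ ∀ g, f (𝒢.src g) = f (𝒢.tgt g)

/-- Two closed basic 1-forms are cohomologous if they differ by `df`, with `f` smooth and basic. -/
def cohomologousSetoid (𝒢 : LieGroupoid n m M G) : Setoid (ClosedBasicOneForm 𝒢) where
  r θ θ' := ∃ f : M → ℝ, IsSmoothBasic 𝒢 f ∧ ∀ x, θ.1.toFun x - θ'.1.toFun x = dFun n f x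
  iseqv :=
    { refl := fun θ => ⟨fun _ => 0, ⟨contMDiff_const, fun _ => rfl⟩, fun x => by
        rw [sub_self]
        exact (mfderiv_const (I := 𝓡 n) (I' := 𝓘(ℝ, ℝ)) (x := x) (c := (0 : ℝ))).symm⟩
      symm := by
        rintro θ θ' ⟨f, ⟨hf, hb⟩, hd⟩
        refine ⟨fun x => -f x, ⟨hf.neg, fun g => congrArg Neg.neg (hb g)⟩, fun x => ?_⟩
        have := mfderiv_neg (I := 𝓡 n) (f := f) (x := x)
        rw [← neg_sub, hd]
        exact this.symm
      trans := by
        rintro θ θ' θ'' ⟨f, ⟨hf, hb⟩, hd⟩ ⟨f', ⟨hf', hb'⟩, hd'⟩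
        refine ⟨fun x => f x + f' x, ⟨hf.add hf', fun g => congrArg₂ (· + ·) (hb g) (hb' g)⟩, fun x => ?_⟩
        have := mfderiv_add (I := 𝓡 n) (z := x) (f := f) (g := f')
          (hf.contMDiffAt.mdifferentiableAt (by simp)) (hf'.contMDiffAt.mdifferentiableAt (by simp))
        rw [← sub_add_sub_cancel _ (θ'.1.toFun x), hd, hd']
        exact this.symm }

/-- The basic cohomology `H¹_bas(G, ℝ)`. -/
def BasicCohomologyOne (𝒢 : LieGroupoid n m M G) : Type _ := Quotient (cohomologousSetoid 𝒢)

/-- The basic cohomology class of a closed basic 1-form. -/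
def basicClass {𝒢 : LieGroupoid n m M G} (θ : ClosedBasicOneForm 𝒢) : BasicCohomologyOne 𝒢 :=
  Quotient.mk (cohomologousSetoid 𝒢) θ

/-- The `G`-path integral `∫_σ ω = ∑ₖ ∫_{σₖ} ω`. -/
noncomputable def OneForm.gPathIntegral {𝒢 : LieGroupoid n m M G} (θ : OneForm n M)
    (σ : GPath 𝒢) : ℝ :=
  ∑ k, θ.pathIntegral (σ.path k)

theorem OneForm.gPathIntegral_sub {𝒢 : LieGroupoid n m M G} (θ θ' : OneForm n M) {f : M → ℝ}
    (hf : IsSmoothBasic 𝒢 f) (hd : ∀ x, θ.toFun x - θ'.toFun x = dFun n f x) (σ : GPath 𝒢) :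
    θ.gPathIntegral σ - θ'.gPathIntegral σ = f σ.finish - f σ.start := by
  rw [OneForm.gPathIntegral, OneForm.gPathIntegral, ← Finset.sum_sub_distrib]
  simp only [OneForm.pathIntegral_sub θ θ' hf.1 hd (σ.piecewiseSmooth _)]
  have hj : ∀ j, f (σ.path (Fin.succ j) 0) = f (σ.path (Fin.castSucc j) 1) := fun j => by
    rw [← σ.src_arrow, ← σ.tgt_arrow, hf.2]
  rw [Finset.sum_sub_distrib, Fin.sum_univ_castSucc (fun k => f (σ.path k 1)),
    Fin.sum_univ_succ (fun k => f (σ.path k 0))]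
  simp only [hj, GPath.finish, GPath.start]
  ring

/-- The periods `Per_ξ([σ]) = ∫_σ ω`, `ξ = [ω]`, on (piecewise smooth representatives of classes of)
`G`-loops at `x₀`; this does not depend on the representative `ω` of `ξ`. -/
noncomputable def period {𝒢 : LieGroupoid n m M G} (ξ : BasicCohomologyOne 𝒢) {x₀ : M}
    (σ : GLoop 𝒢 x₀) : ℝ :=
  Quotient.lift (s := cohomologousSetoid 𝒢) (fun θ => θ.1.gPathIntegral σ.1)
    (by
      rintro θ θ' ⟨f, hf, hd⟩
      have h := OneForm.gPathIntegral_sub θ.1 θ'.1 hf hd σ.1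
      rw [σ.2.1, σ.2.2, sub_self] at h
      exact sub_eq_zero.1 h) ξ

/-- `ξ` is integral if its periods are integers. -/
def BasicCohomologyOne.IsIntegral {𝒢 : LieGroupoid n m M G} (ξ : BasicCohomologyOne 𝒢) : Prop :=
  ∀ (x₀ : M) (σ : GLoop 𝒢 x₀), ∃ k : ℤ, period ξ σ = k

/-- Condition (2) for a Lyapunov 1-form: there are an open neighbourhood `V` of `Y` in the orbit
space and a smooth function `f` on `V` (that is, `f ∘ π` is smooth on `π⁻¹(V)`) such that `ω = df`
on `V` and `df` vanishes on `Y`. Only the values of `f` on `V` matter. -/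
def ClosedBasicOneForm.IsExactNear {𝒢 : LieGroupoid n m M G} (θ : ClosedBasicOneForm 𝒢)
    (Y : Set 𝒢.OrbitSpace) : Prop :=
  ∃ V : Set 𝒢.OrbitSpace, IsOpen V ∧ Y ⊆ V ∧ ∃ f : 𝒢.OrbitSpace → ℝ,
    ContMDiffOn (𝓡 n) 𝓘(ℝ, ℝ) ∞ (fun x => f (𝒢.proj x)) (𝒢.proj ⁻¹' V) ∧
    (∀ x ∈ 𝒢.proj ⁻¹' V, θ.1.toFun x = dFun n (fun x => f (𝒢.proj x)) x) ∧
    ∀ x ∈ 𝒢.proj ⁻¹' Y, dFun n (fun x => f (𝒢.proj x)) x = 0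

end Basic

/-! Only the passage from vanishing on $N$ to a primitive near $Y$ has content. Fix a base point and
integrate $\omega$ along $G$-paths. Two $G$-paths with the same ends can be closed up by a common
return path, so integrality makes the integral well defined modulo $\mathbb Z$: this gives an
arrow-invariant map $\varphi\colon M\to\mathbb R/\mathbb Z$ with $d\varphi=\omega$
(`ClosedBasicOneForm.exists_primitive_mod_int`).

The points of $N$ are critical for $\varphi$. By Sard's theorem (`volume_image_critical_eq_zero`),
applied to countably many local primitives, the critical values are null, so some $c$ is not a
critical value modulo $\mathbb Z$ (`OneForm.exists_forall_toIcoMod_ne`). The circle minus the class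
of $c$ lifts to $(c,c+1)$, so where $\varphi\neq c$ the representative `toIcoMod` is a smooth real
primitive (`eventually_toIcoMod_eq`). This open set contains $N$, and invariance lets both the set
and the function descend to $X$. -/

/-! ### Sard's theorem for real-valued functions -/

section Sard

open MeasureTheory Topology Module

variable {E F : Type*} [NormedAddCommGroup E] [NormedSpace ℝ E]
  [NormedAddCommGroup F] [NormedSpace ℝ F]

/-- Mean value inequality on the segment from `z` to `y`, where `‖w - z‖ ≤ ‖y - z‖`. Each use gains
one power of the distance. -/
theorem Convex.norm_image_sub_le_pow_succ_of_norm_fderiv_le {g : E → F} {W : Set E}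
    (hW : Convex ℝ W) (hg : ∀ w ∈ W, DifferentiableAt ℝ g w) {C : ℝ} (hC : 0 ≤ C) {i : ℕ} {z : E}
    (hz : z ∈ W) (hb : ∀ w ∈ W, ‖fderiv ℝ g w‖ ≤ C * ‖w - z‖ ^ i) {y : E} (hy : y ∈ W) :
    ‖g y - g z‖ ≤ C * ‖y - z‖ ^ (i + 1) := by
  have hs : segment ℝ z y ⊆ W := hW.segment_subset hz hy
  have h := (convex_segment z y).norm_image_sub_le_of_norm_fderiv_le (𝕜 := ℝ) (f := g)
    (C := C * ‖y - z‖ ^ i) (fun w hw => hg w (hs hw))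
    (fun w hw => (hb w (hs hw)).trans (by
      have := norm_sub_le_of_mem_segment hw
      gcongr))
    (left_mem_segment ℝ z y) (right_mem_segment ℝ z y)
  calc _ ≤ _ := h
    _ = _ := by ring

/-- A `C^{k+1}` function whose derivatives of orders `1, …, k` vanish at `z` varies by
`O(‖y - z‖^{k+1})`, locally uniformly in `z`. -/
theorem ContDiffAt.exists_nhds_norm_sub_le_pow_of_flat {f : E → F} {x : E} {k : ℕ}
    (hf : ContDiffAt ℝ (k + 1 : ℕ) f x) :
    ∃ C : ℝ, 0 ≤ C ∧ ∃ W ∈ 𝓝 x, ∀ z ∈ W,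
      (∀ j, 1 ≤ j → j ≤ k → iteratedFDeriv ℝ j f z = 0) →
      ∀ y ∈ W, ‖f y - f z‖ ≤ C * ‖y - z‖ ^ (k + 1) := by
  have h1 : ∀ᶠ y in 𝓝 x, ContDiffAt ℝ (k + 1 : ℕ) f y := hf.eventually (by simp)
  have h2 : ContDiffAt ℝ 0 (iteratedFDeriv ℝ (k + 1) f) x := hf.iteratedFDeriv_right (by simp)
  have h3 : ∀ᶠ y in 𝓝 x, ‖iteratedFDeriv ℝ (k + 1) f y‖ < ‖iteratedFDeriv ℝ (k + 1) f x‖ + 1 :=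
    h2.continuousAt.norm.eventually_lt_const (lt_add_one _)
  obtain ⟨r, hr, hW⟩ := Metric.eventually_nhds_iff_ball.1 (h1.and h3)
  refine ⟨‖iteratedFDeriv ℝ (k + 1) f x‖ + 1, by positivity, Metric.ball x r,
    Metric.ball_mem_nhds x hr, fun z hz hflat => ?_⟩
  have hC : 0 ≤ ‖iteratedFDeriv ℝ (k + 1) f x‖ + 1 := by positivity
  -- Descend from the bounded derivative of order `k + 1`: each lower derivative vanishes at `z`, so
  -- integrating the bound for the next order gains a factor `‖y - z‖`.
  have key : ∀ i ≤ k, ∀ y ∈ Metric.ball x r,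
      ‖iteratedFDeriv ℝ (k + 1 - i) f y‖ ≤ (‖iteratedFDeriv ℝ (k + 1) f x‖ + 1) * ‖y - z‖ ^ i := by
    intro i
    induction i with
    | zero => intro _ y hy; simpa using (hW y hy).2.le
    | succ i ih =>
      intro hi y hy
      have e : k + 1 - i = (k + 1 - (i + 1)) + 1 := by omega
      have h := (convex_ball x r).norm_image_sub_le_pow_succ_of_norm_fderiv_le
        (g := iteratedFDeriv ℝ (k + 1 - (i + 1)) f) (i := i)
        (fun w hw => (((hW w hw).1.iteratedFDeriv_right (m := 1) (i := k + 1 - (i + 1)) (by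
          norm_cast; omega)).differentiableAt (by simp))) hC hz
        (fun w hw => by
          rw [norm_fderiv_iteratedFDeriv, ← e]
          exact ih (by omega) w hw) hy
      rwa [hflat _ (by omega) (by omega), sub_zero] at h
  intro y hy
  refine (convex_ball x r).norm_image_sub_le_pow_succ_of_norm_fderiv_le
    (fun w hw => (hW w hw).1.differentiableAt (by simp)) hC hz (fun w hw => ?_) hy
  have := key k le_rfl w hw
  rwa [Nat.add_sub_cancel_left, norm_iteratedFDeriv_one] at this

/-- Second countability reduces the cover by the sets `W` to a countable one. -/
theorem volume_image_eq_zero_of_locally {X : Type*} [TopologicalSpace X]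
    [SecondCountableTopology X] {f : X → ℝ} {A : Set X}
    (h : ∀ x ∈ A, ∃ W ∈ 𝓝 x, volume (f '' (A ∩ W)) = 0) : volume (f '' A) = 0 := by
  choose! W hW h0 using h
  obtain ⟨t, htA, htc, ht⟩ := TopologicalSpace.countable_cover_nhdsWithin
    (fun x hx => mem_nhdsWithin_of_mem_nhds (hW x hx))
  have hsub : f '' A ⊆ ⋃ x ∈ t, f '' (A ∩ W x) := by
    rintro _ ⟨y, hy, rfl⟩
    obtain ⟨x, hx, hyx⟩ := mem_iUnion₂.1 (ht hy)
    exact mem_iUnion₂.2 ⟨x, hx, y, ⟨hy, hyx⟩, rfl⟩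
  exact measure_mono_null hsub ((measure_biUnion_null_iff htc).2 fun x hx => h0 x (htA hx))

variable [FiniteDimensional ℝ E]

/-- The image of the set where the derivatives of orders `1, …, dim E` vanish is a null set. -/
theorem volume_image_eq_zero_of_flat {f : E → ℝ} {A : Set E}
    (hf : ∀ x ∈ A, ContDiffAt ℝ ∞ f x)
    (hA : ∀ x ∈ A, ∀ j, 1 ≤ j → j ≤ finrank ℝ E → iteratedFDeriv ℝ j f x = 0) :
    volume (f '' A) = 0 := by
  have : ProperSpace E := FiniteDimensional.proper ℝ E
  refine volume_image_eq_zero_of_locally fun x hx => ?_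
  obtain ⟨C, hC, W, hW, h⟩ := ContDiffAt.exists_nhds_norm_sub_le_pow_of_flat
    (k := finrank ℝ E) ((hf x hx).of_le (by exact_mod_cast le_top))
  refine ⟨W, hW, ?_⟩
  -- Hölder exponent `dim E + 1` forces the image to have Hausdorff dimension at most `dim E / (dim
  -- E + 1) < 1`.
  have hH : HolderOnWith ⟨C, hC⟩ ((finrank ℝ E + 1 : ℕ) : NNReal) f (A ∩ W) := by
    intro y hy z hz
    have := h z hz.2 (hA z hz.1) y hy.2
    rw [edist_dist, edist_dist, dist_eq_norm, dist_eq_norm, NNReal.coe_natCast,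
      ENNReal.rpow_natCast, ← ENNReal.ofReal_pow (norm_nonneg _)]
    refine (ENNReal.ofReal_le_ofReal this).trans ?_
    rw [ENNReal.ofReal_mul hC]
    gcongr
    rw [ENNReal.ofReal, Real.toNNReal_of_nonneg hC]
    exact le_rfl
  have hd := hH.dimH_image_le (by positivity)
  have hlt : dimH (f '' (A ∩ W)) < ((1 : NNReal) : ENNReal) := by
    refine hd.trans_lt ?_
    have h1 : dimH (A ∩ W) ≤ finrank ℝ E :=
      (dimH_mono (subset_univ _)).trans (Real.dimH_univ_eq_finrank E).le
    refine (ENNReal.div_le_div_right h1 _).trans_lt ?_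
    rw [ENNReal.div_lt_iff (by simp) (by simp)]
    rw [ENNReal.coe_one, one_mul]
    norm_cast
    omega
  have h0 := hausdorffMeasure_of_dimH_lt hlt
  rwa [NNReal.coe_one, hausdorffMeasure_real] at h0

/-- Near a regular point `x` of `g`, the zero set of `g` is parametrised by a hyperplane. -/
theorem exists_parametrisation_of_zero_set {g : E → ℝ} {x : E} (hg : ContDiffAt ℝ ∞ g x)
    (h0 : fderiv ℝ g x ≠ 0) :
    ∃ (K : Submodule ℝ E), K ≠ ⊤ ∧ ∃ (h : K → E), ∃ W ∈ 𝓝 x, ∀ y ∈ W, g y = 0 →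
      ContDiffAt ℝ ∞ g y → ∃ z : K, h z = y ∧ ContDiffAt ℝ ∞ h z := by
  have : CompleteSpace E := FiniteDimensional.complete ℝ E
  obtain ⟨v, hv⟩ : ∃ v, fderiv ℝ g x v = 1 := by
    obtain ⟨u, hu⟩ := DFunLike.ne_iff.1 h0
    refine ⟨(fderiv ℝ g x u)⁻¹ • u, ?_⟩
    rw [map_smul, smul_eq_mul]
    exact inv_mul_cancel₀ hu
  set L := fderiv ℝ g x with hL
  -- Since `L v = 1`, this choice gives `L (Φ y - x) = g y`, so `Φ` carries zeros of `g` into `x +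
  -- ker L`. Its derivative at `x` is the identity, so it is locally invertible.
  let Φ : E → E := fun y => y + (g y - L (y - x)) • v
  have hΦs : ∀ y, ContDiffAt ℝ ∞ g y → ContDiffAt ℝ ∞ Φ y := fun y hy => by
    have : ContDiffAt ℝ ∞ (fun y => L (y - x)) y :=
      L.contDiff.contDiffAt.comp y (contDiffAt_id.sub contDiffAt_const)
    exact contDiffAt_id.add ((hy.sub this).smul contDiffAt_const)
  have hΦ' : HasFDerivAt Φ ((ContinuousLinearEquiv.refl ℝ E : E ≃L[ℝ] E) : E →L[ℝ] E) x := by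
    have h1 : HasFDerivAt g L x := (hg.differentiableAt (by simp)).hasFDerivAt
    have h2 : HasFDerivAt (fun y => L (y - x)) L x :=
      L.hasFDerivAt.comp x ((hasFDerivAt_id x).sub_const x)
    have := (hasFDerivAt_id x).add ((h1.sub h2).smul_const v)
    refine this.congr_fderiv ?_
    ext u
    simp
  have hΦx := hΦs x hg
  let e := hΦx.toOpenPartialHomeomorph Φ hΦ' (by simp)
  have hxe : x ∈ e.source := hΦx.mem_toOpenPartialHomeomorph_source hΦ' (by simp)
  have hec : (e : E → E) = Φ := rfl
  -- Smoothness of the inverse at `Φ y` needs an invertible derivative at `y` itself, not only at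
  -- `x`; invertibility is an open condition.
  have hinv : ∀ᶠ y in 𝓝 x, fderiv ℝ Φ y ∈
      range ((↑) : (E ≃L[ℝ] E) → E →L[ℝ] E) := by
    have hc : ContinuousAt (fderiv ℝ Φ) x :=
      (hΦx.fderiv_right (m := 0) (by simp)).continuousAt
    refine hc.eventually_mem ?_
    rw [hΦ'.fderiv]
    exact ContinuousLinearEquiv.nhds _
  refine ⟨LinearMap.ker (L : E →ₗ[ℝ] ℝ), ?_, fun z => e.symm (x + z), _,
    (e.open_source.mem_nhds hxe) |> fun h => Filter.inter_mem h hinv, ?_⟩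
  · intro h
    have : v ∈ LinearMap.ker (L : E →ₗ[ℝ] ℝ) := h ▸ Submodule.mem_top
    rw [LinearMap.mem_ker] at this
    exact one_ne_zero (hv.symm.trans this)
  · rintro y ⟨hye, ⟨f', hf'⟩⟩ hgy hgs
    have hz : L (Φ y - x) = 0 := by
      simp only [Φ, map_sub, map_add, map_smul, hv, hgy, smul_eq_mul]
      ring
    refine ⟨⟨Φ y - x, hz⟩, ?_, ?_⟩
    · simp only [add_sub_cancel]
      exact e.left_inv hye
    · have hy' : e.symm (Φ y) = y := e.left_inv hye
      have hs : ContDiffAt ℝ ∞ e.symm (Φ y) := by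
        refine e.contDiffAt_symm (e.map_source hye) (f₀' := f') ?_ ?_
        · rw [hy', hec, hf']
          exact ((hΦs y hgs).differentiableAt (by simp)).hasFDerivAt
        · rw [hy']
          exact hΦs y hgs
      have hsub : ContDiff ℝ ∞ (fun z : LinearMap.ker (L : E →ₗ[ℝ] ℝ) => x + (z : E)) :=
        contDiff_const.add (LinearMap.ker (L : E →ₗ[ℝ] ℝ)).subtypeL.contDiff
      refine ContDiffAt.comp (g := e.symm) _ ?_ hsub.contDiffAt
      simpa using hs

/-- Sard's theorem for real-valued functions. -/
theorem volume_image_critical_eq_zero {f : E → ℝ} {A : Set E}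
    (hf : ∀ x ∈ A, ContDiffAt ℝ ∞ f x) (hA : ∀ x ∈ A, fderiv ℝ f x = 0) :
    volume (f '' A) = 0 := by
  induction hn : finrank ℝ E using Nat.strong_induction_on generalizing E with
  | _ n ih =>
  have : ProperSpace E := FiniteDimensional.proper ℝ E
  let A' : ℕ → Set E := fun k => {x ∈ A | ∀ j, 1 ≤ j → j ≤ k → iteratedFDeriv ℝ j f x = 0}
  have hflat : volume (f '' (A' n)) = 0 :=
    volume_image_eq_zero_of_flat (fun x hx => hf x hx.1) (fun x hx j h1 h2 => hx.2 j h1 (hn ▸ h2))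
  -- Near a point of this stratum, some partial derivative `g` of order `k + 1` has nonzero
  -- differential while vanishing on the whole stratum. The stratum thus lies in a hypersurface,
  -- where the induction hypothesis applies to the restriction of `f`.
  have hstep : ∀ k, volume (f '' (A' (k + 1) \ A' (k + 2))) = 0 := by
    intro k
    refine volume_image_eq_zero_of_locally fun x hx => ?_
    have hne : iteratedFDeriv ℝ (k + 2) f x ≠ 0 := fun h => hx.2 ⟨hx.1.1, fun j h1 h2 => by
      rcases h2.eq_or_lt with rfl | h2
      · exact h
      · exact hx.1.2 j h1 (by omega)⟩
    obtain ⟨v, hv⟩ := DFunLike.ne_iff.1 hne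
    -- The entry `v 0` is kept back: it is the direction in which `g` has nonzero derivative at `x`.
    let g : E → ℝ := fun y => iteratedFDeriv ℝ (k + 1) f y (Fin.tail v)
    have hgs : ∀ y, ContDiffAt ℝ ∞ f y → ContDiffAt ℝ ∞ g y := fun y hy =>
      (ContinuousMultilinearMap.apply ℝ (fun _ : Fin (k + 1) => E) ℝ
        (Fin.tail v)).contDiff.contDiffAt.comp y
        (hy.iteratedFDeriv_right (m := ∞) (i := k + 1) (by exact_mod_cast le_top))
    have hgd : fderiv ℝ g x ≠ 0 := by
      intro h
      apply hv
      have h1 : DifferentiableAt ℝ (iteratedFDeriv ℝ (k + 1) f) x :=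
        ((hf x hx.1.1).iteratedFDeriv_right (m := 1) (i := k + 1)
          (by exact_mod_cast le_top)).differentiableAt (by simp)
      have h2 : HasFDerivAt g _ x := (ContinuousMultilinearMap.apply ℝ (fun _ : Fin (k + 1) => E) ℝ
        (Fin.tail v)).hasFDerivAt.comp x h1.hasFDerivAt
      rw [iteratedFDeriv_succ_apply_left]
      have h3 := congrArg (fun T => T (v 0)) (h2.fderiv.symm.trans h)
      simpa using h3
    obtain ⟨K, hK, h, W, hW, hpar⟩ := exists_parametrisation_of_zero_set (hgs x (hf x hx.1.1)) hgd
    refine ⟨W, hW, ?_⟩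
    let B : Set K := {z | h z ∈ A ∧ ContDiffAt ℝ ∞ h z}
    have hB : volume ((f ∘ h) '' B) = 0 := by
      refine ih (finrank ℝ K) (hn ▸ Submodule.finrank_lt hK)
        (fun z hz => (hf _ hz.1).comp z hz.2) (fun z hz => ?_) rfl
      rw [fderiv_comp z ((hf _ hz.1).differentiableAt (by simp)) (hz.2.differentiableAt (by simp)),
        hA _ hz.1, ContinuousLinearMap.zero_comp]
    refine measure_mono_null ?_ hB
    rintro _ ⟨y, ⟨hy, hyW⟩, rfl⟩
    have hgy : g y = 0 := by
      simp only [g]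
      rw [hy.1.2 (k + 1) (by omega) le_rfl]
      rfl
    obtain ⟨z, hz, hzs⟩ := hpar y hyW hgy (hgs y (hf y hy.1.1))
    exact ⟨z, ⟨hz ▸ hy.1.1, hzs⟩, congrArg f hz⟩
  have hk : ∀ k, volume (f '' (A' 1 \ A' (k + 1))) = 0 := by
    intro k
    induction k with
    | zero => simp
    | succ k ihk =>
      refine measure_mono_null ?_ (measure_union_null ihk (hstep k))
      rintro _ ⟨y, ⟨hy, hy'⟩, rfl⟩
      by_cases h : y ∈ A' (k + 1)
      · exact Or.inr ⟨y, ⟨h, hy'⟩, rfl⟩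
      · exact Or.inl ⟨y, ⟨hy, h⟩, rfl⟩
  -- As `A = A' 1` and the sets `A' k` decrease, a point of `A` outside `A' n` lies in `A' 1 \ A' (n
  -- + 1)`.
  refine measure_mono_null ?_ (measure_union_null hflat (hk n))
  rintro _ ⟨y, hy, rfl⟩
  by_cases h : y ∈ A' n
  · exact Or.inl ⟨y, h, rfl⟩
  · refine Or.inr ⟨y, ⟨⟨hy, fun j h1 h2 => ?_⟩, fun h' => h ⟨hy, fun j h1 h2 => h'.2 j h1 (by omega)⟩⟩, rfl⟩
    obtain rfl : j = 1 := by omega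
    rw [← norm_eq_zero, norm_iteratedFDeriv_one, hA y hy, norm_zero]

end Sard

/-! ### Local primitives of closed 1-forms -/

section LocalPrimitive

open MeasureTheory Topology

variable {n : ℕ} {M : Type*} [TopologicalSpace M] [ChartedSpace (EuclideanSpace ℝ (Fin n)) M]
  [IsManifold (𝓡 n) ∞ M]

/-- On a fixed vector, the local representation is the pairing of two smooth objects along the
inverse chart: the section `θ` and the image of the vector under the tangent map. -/
theorem OneForm.contDiffOn_inChart (θ : OneForm n M) (x₀ : M) :
    ContDiffOn ℝ ∞ (θ.inChart x₀) (extChartAt (𝓡 n) x₀).target := by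
  set T := (extChartAt (𝓡 n) x₀).target with hT
  have hTo : IsOpen T := isOpen_extChartAt_target x₀
  have hu : UniqueMDiffOn 𝓘(ℝ, EuclideanSpace ℝ (Fin n)) T := hTo.uniqueMDiffOn
  have hγ := contMDiffOn_extChartAt_symm (I := 𝓡 n) (n := ∞) x₀
  rw [contDiffOn_clm_apply]
  intro v
  have h1 : ContMDiffOn 𝓘(ℝ, EuclideanSpace ℝ (Fin n)) (𝓡 n).tangent ∞
      (fun y : EuclideanSpace ℝ (Fin n) => (⟨(extChartAt (𝓡 n) x₀).symm y,
        (mfderivWithin 𝓘(ℝ, EuclideanSpace ℝ (Fin n)) (𝓡 n) (extChartAt (𝓡 n) x₀).symm T y :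
          EuclideanSpace ℝ (Fin n) →L[ℝ] TangentSpace (𝓡 n) ((extChartAt (𝓡 n) x₀).symm y)) v⟩ :
        TangentBundle (𝓡 n) M)) T := by
    have h := hγ.contMDiffOn_tangentMapWithin (m := ∞) (by simp) hu
    have hs : ContMDiffOn 𝓘(ℝ, EuclideanSpace ℝ (Fin n))
        𝓘(ℝ, EuclideanSpace ℝ (Fin n)).tangent ∞
        (fun y : EuclideanSpace ℝ (Fin n) =>
          (⟨y, v⟩ : TangentBundle 𝓘(ℝ, EuclideanSpace ℝ (Fin n)) (EuclideanSpace ℝ (Fin n)))) T :=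
      contMDiffOn_vectorSpace_iff_contDiffOn.2 contDiffOn_const
    exact h.comp hs (fun t ht => ht)
  have h2 := θ.smooth.comp_contMDiffOn hγ
  have h3 : ContMDiffOn 𝓘(ℝ, EuclideanSpace ℝ (Fin n)) ((𝓡 n).prod 𝓘(ℝ, ℝ)) ∞
      (fun y : EuclideanSpace ℝ (Fin n) => Bundle.TotalSpace.mk' ℝ (E := Bundle.Trivial M ℝ)
        ((extChartAt (𝓡 n) x₀).symm y) (θ.toFun ((extChartAt (𝓡 n) x₀).symm y)
        ((mfderivWithin 𝓘(ℝ, EuclideanSpace ℝ (Fin n)) (𝓡 n) (extChartAt (𝓡 n) x₀).symm T y :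
          EuclideanSpace ℝ (Fin n) →L[ℝ] TangentSpace (𝓡 n) ((extChartAt (𝓡 n) x₀).symm y)) v)))
      T :=
    ContMDiffOn.clm_bundle_apply (E₁ := fun x : M => TangentSpace (𝓡 n) x)
      (E₂ := Bundle.Trivial M ℝ) (F₁ := EuclideanSpace ℝ (Fin n)) (F₂ := ℝ) h2 h1
  refine contMDiffOn_iff_contDiffOn.1 fun y hy => ?_
  have h4 := h3 y hy
  simp only [Bundle.contMDiffWithinAt_totalSpace] at h4
  refine h4.2.congr (fun z hz => ?_) ?_
  · simp only [OneForm.inChart, mfderivWithin_of_isOpen hTo hz]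
    rfl
  · simp only [OneForm.inChart, mfderivWithin_of_isOpen hTo hy]
    rfl

theorem OneForm.toFun_symm_eq_inChart_comp (θ : OneForm n M) {x₀ : M}
    {y : EuclideanSpace ℝ (Fin n)} (hy : y ∈ (extChartAt (𝓡 n) x₀).target) :
    θ.toFun ((extChartAt (𝓡 n) x₀).symm y) = (θ.inChart x₀ y).comp
      (mfderiv (𝓡 n) 𝓘(ℝ, EuclideanSpace ℝ (Fin n)) (extChartAt (𝓡 n) x₀)
        ((extChartAt (𝓡 n) x₀).symm y)) := by
  have : IsManifold (𝓡 n) 1 M := .of_le (n := ∞) (by simp)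
  have h := mfderivWithin_extChartAt_symm_comp_mfderiv_extChartAt (I := 𝓡 n) hy
  simp only [modelWithCornersSelf_coe, range_id, mfderivWithin_univ] at h
  ext v
  exact congrArg (θ.toFun ((extChartAt (𝓡 n) x₀).symm y)) (congrArg (fun T => T v) h).symm

theorem OneForm.toFun_eq_inChart_comp (θ : OneForm n M) {x₀ x : M}
    (hx : x ∈ (extChartAt (𝓡 n) x₀).source) :
    θ.toFun x = (θ.inChart x₀ (extChartAt (𝓡 n) x₀ x)).comp
      (mfderiv (𝓡 n) 𝓘(ℝ, EuclideanSpace ℝ (Fin n)) (extChartAt (𝓡 n) x₀) x) := by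
  have h := θ.toFun_symm_eq_inChart_comp ((extChartAt (𝓡 n) x₀).map_source hx)
  rwa [(extChartAt (𝓡 n) x₀).left_inv hx] at h

/-- Along a smooth path in an open set where `θ = dH`, the integral of `θ` is the increment of
`H`. -/
theorem OneForm.pathIntegral_eq_sub_of_contMDiffOn (θ : OneForm n M) {W : Set M} (hW : IsOpen W)
    {H : M → ℝ} (hH : ContMDiffOn (𝓡 n) 𝓘(ℝ, ℝ) ∞ H W) (hd : ∀ x ∈ W, θ.toFun x = dFun n H x)
    {γ : ℝ → M} (hγ : ContMDiffOn 𝓘(ℝ, ℝ) (𝓡 n) ∞ γ (Icc 0 1)) (hγW : MapsTo γ (Icc 0 1) W) :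
    θ.pathIntegral γ = H (γ 1) - H (γ 0) := by
  refine intervalIntegral.integral_eq_sub_of_hasDerivAt_of_le (f := fun s => H (γ s))
    zero_le_one (hH.continuousOn.comp hγ.continuousOn hγW) ?_
    (θ.intervalIntegrable_piece zero_le_one hγ)
  intro s hs
  have hsW : γ s ∈ W := hγW (Ioo_subset_Icc_self hs)
  have hγs : MDifferentiableAt 𝓘(ℝ, ℝ) (𝓡 n) γ s :=
    (hγ.contMDiffAt (Icc_mem_nhds hs.1 hs.2)).mdifferentiableAt (by simp)
  have hHs : MDifferentiableAt (𝓡 n) 𝓘(ℝ, ℝ) H (γ s) :=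
    (hH.contMDiffAt (hW.mem_nhds hsW)).mdifferentiableAt (by simp)
  obtain ⟨L, hL⟩ : ∃ L : ℝ →L[ℝ] ℝ, L = (mfderiv (𝓡 n) 𝓘(ℝ, ℝ) H (γ s)).comp
      (mfderiv 𝓘(ℝ, ℝ) (𝓡 n) γ s) := ⟨_, rfl⟩
  have hc : HasFDerivAt (fun s => H (γ s)) L s := by
    rw [hL]
    exact (hHs.hasMFDerivAt.comp s hγs.hasMFDerivAt).hasFDerivAt
  refine hc.hasDerivAt.congr_deriv ?_
  rw [hL]
  exact (congrArg (fun L => L ((mfderiv 𝓘(ℝ, ℝ) (𝓡 n) γ s :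
    ℝ →L[ℝ] TangentSpace (𝓡 n) (γ s)) 1)) (hd (γ s) hsW)).symm

/-- A closed 1-form has a primitive near each point; the critical values of this primitive form a
null set, and its increments are path integrals of the form. -/
theorem OneForm.IsClosed.exists_local_primitive {θ : OneForm n M} (hθ : θ.IsClosed) (x₀ : M) :
    ∃ W : Set M, IsOpen W ∧ x₀ ∈ W ∧ ∃ H : M → ℝ, ContMDiffOn (𝓡 n) 𝓘(ℝ, ℝ) ∞ H W ∧
      (∀ x ∈ W, θ.toFun x = dFun n H x) ∧
      (∀ x ∈ W, ∃ γ : ℝ → M, IsPiecewiseSmooth n γ ∧ γ 0 = x₀ ∧ γ 1 = x ∧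
        θ.pathIntegral γ = H x - H x₀) ∧
      volume (H '' {x ∈ W | θ.toFun x = 0}) = 0 := by
  set φ := extChartAt (𝓡 n) x₀ with hφ
  have hTo : IsOpen φ.target := isOpen_extChartAt_target x₀
  obtain ⟨r, hr, hB⟩ := Metric.isOpen_iff.1 hTo (φ x₀) (mem_extChartAt_target x₀)
  have hη := θ.contDiffOn_inChart x₀
  -- Poincaré lemma on a ball in the chart: closedness is the symmetry of the derivative of the
  -- local representation.
  obtain ⟨h, hh⟩ := (convex_ball (φ x₀) r).exists_forall_hasFDerivAt_of_fderiv_symmetric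
    Metric.isOpen_ball ((hη.mono hB).differentiableOn (by simp))
    (fun y hy u v => sub_eq_zero.1 (hθ x₀ y (hB hy) u v))
  have hhs : ContDiffOn ℝ ∞ h (Metric.ball (φ x₀) r) := by
    refine (contDiffOn_infty_iff_fderiv_of_isOpen Metric.isOpen_ball).2
      ⟨fun y hy => (hh y hy).differentiableAt.differentiableWithinAt, ?_⟩
    exact (hη.mono hB).congr fun y hy => (hh y hy).fderiv
  set W : Set M := φ.source ∩ φ ⁻¹' Metric.ball (φ x₀) r with hWdef
  have hW : IsOpen W := isOpen_extChartAt_preimage' x₀ Metric.isOpen_ball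
  have hφW : ContMDiffOn (𝓡 n) 𝓘(ℝ, EuclideanSpace ℝ (Fin n)) ∞ φ W := by
    refine (contMDiffOn_extChartAt (I := 𝓡 n) (x := x₀)).mono fun x hx => ?_
    simpa [hφ] using hx.1
  have hHW : ContMDiffOn (𝓡 n) 𝓘(ℝ, ℝ) ∞ (h ∘ φ) W :=
    hhs.contMDiffOn.comp hφW fun x hx => hx.2
  have hd : ∀ x ∈ W, θ.toFun x = dFun n (h ∘ φ) x := by
    intro x hx
    have h1 : MDifferentiableAt (𝓡 n) 𝓘(ℝ, EuclideanSpace ℝ (Fin n)) φ x :=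
      (hφW.contMDiffAt (hW.mem_nhds hx)).mdifferentiableAt (by simp)
    have h2 := ((hh (φ x) hx.2).hasMFDerivAt.comp x h1.hasMFDerivAt).mfderiv
    rw [θ.toFun_eq_inChart_comp hx.1]
    exact h2.symm
  have hx₀ : x₀ ∈ W := ⟨mem_extChartAt_source x₀, Metric.mem_ball_self hr⟩
  refine ⟨W, hW, hx₀, h ∘ φ, hHW, hd, fun x hx => ?_, ?_⟩
  · let γ : ℝ → M := fun t => φ.symm (AffineMap.lineMap (φ x₀) (φ x) t)
    have hline : ∀ t ∈ Icc (0 : ℝ) 1,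
        AffineMap.lineMap (φ x₀) (φ x) t ∈ Metric.ball (φ x₀) r := fun t ht =>
      (convex_ball (φ x₀) r).lineMap_mem (Metric.mem_ball_self hr) hx.2 ht
    have hγ : ContMDiffOn 𝓘(ℝ, ℝ) (𝓡 n) ∞ γ (Icc 0 1) := by
      have h1 : ContDiff ℝ ∞ (AffineMap.lineMap (φ x₀) (φ x) : ℝ → EuclideanSpace ℝ (Fin n)) := by
        have : (AffineMap.lineMap (φ x₀) (φ x) : ℝ → EuclideanSpace ℝ (Fin n)) =
            fun t => t • (φ x - φ x₀) + φ x₀ := by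
          ext1 t
          rw [AffineMap.lineMap_apply]
          rfl
        rw [this]
        fun_prop
      exact (contMDiffOn_extChartAt_symm (I := 𝓡 n) (n := ∞) x₀).comp
        h1.contMDiff.contMDiffOn fun t ht => hB (hline t ht)
    have hγW : MapsTo γ (Icc 0 1) W := fun t ht => by
      refine ⟨φ.map_target (hB (hline t ht)), ?_⟩
      rw [mem_preimage, φ.right_inv (hB (hline t ht))]
      exact hline t ht
    have hγ0 : γ 0 = x₀ := by
      simp only [γ, AffineMap.lineMap_apply_zero]
      exact φ.left_inv hx₀.1
    have hγ1 : γ 1 = x := by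
      simp only [γ, AffineMap.lineMap_apply_one]
      exact φ.left_inv hx.1
    refine ⟨γ, ⟨1, fun i => i, Nat.mono_cast, by simp, by simp, fun i hi => ?_⟩, hγ0, hγ1, ?_⟩
    · obtain rfl : i = 0 := by omega
      simpa using hγ
    · rw [θ.pathIntegral_eq_sub_of_contMDiffOn hW hHW hd hγ hγW, hγ0, hγ1]
  -- Zeros of `θ` in `W` correspond in the chart to critical points of `h`, so Sard's theorem
  -- applies there.
  · refine measure_mono_null ?_ (volume_image_critical_eq_zero (f := h)
      (A := {y ∈ Metric.ball (φ x₀) r | θ.inChart x₀ y = 0})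
      (fun y hy => hhs.contDiffAt (Metric.isOpen_ball.mem_nhds hy.1))
      (fun y hy => (hh y hy.1).fderiv.trans hy.2))
    rintro _ ⟨x, ⟨hx, hx0⟩, rfl⟩
    refine ⟨φ x, ⟨hx.2, ?_⟩, rfl⟩
    rw [OneForm.inChart, φ.left_inv hx.1, hx0]
    exact ContinuousLinearMap.zero_comp _

end LocalPrimitive

/-! ### Concatenation of $G$-paths -/

section GPathOperations

variable {n m : ℕ} {M G : Type*}
  [TopologicalSpace M] [ChartedSpace (EuclideanSpace ℝ (Fin n)) M]
  [TopologicalSpace G] [ChartedSpace (EuclideanSpace ℝ (Fin m)) G]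
  {𝒢 : LieGroupoid n m M G}

theorem dFun_add_const {H : M → ℝ} {x : M} (hH : MDifferentiableAt (𝓡 n) 𝓘(ℝ, ℝ) H x) (c : ℝ) :
    dFun n (fun y => H y + c) x = dFun n H x := by
  have h := (hH.hasMFDerivAt.add (hasMFDerivAt_const (I := 𝓡 n) (I' := 𝓘(ℝ, ℝ)) c x)).mfderiv
  exact h.trans (add_zero (dFun n H x))

theorem isPiecewiseSmooth_const (x : M) : IsPiecewiseSmooth n (fun _ : ℝ => x) :=
  ⟨1, fun i => i, Nat.mono_cast, by simp, by simp, fun _ _ => contMDiffOn_const⟩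

namespace GPath

/-- The `G`-path `γ g σ`. -/
def snoc (σ : GPath 𝒢) (g : G) (γ : ℝ → M) (hγ : IsPiecewiseSmooth n γ)
    (hs : 𝒢.src g = σ.finish) (ht : 𝒢.tgt g = γ 0) : GPath 𝒢 where
  order := σ.order + 1
  path := Fin.snoc (α := fun _ => ℝ → M) σ.path γ
  arrow := Fin.snoc (α := fun _ => G) σ.arrow g
  piecewiseSmooth j := by
    induction j using Fin.lastCases with
    | last => rwa [Fin.snoc_last]
    | cast j =>
      rw [Fin.snoc_castSucc]
      exact σ.piecewiseSmooth j
  src_arrow j := by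
    rw [Fin.snoc_castSucc]
    induction j using Fin.lastCases with
    | last => rwa [Fin.snoc_last]
    | cast j =>
      rw [Fin.snoc_castSucc]
      exact σ.src_arrow j
  tgt_arrow j := by
    induction j using Fin.lastCases with
    | last => rwa [Fin.snoc_last, Fin.succ_last, Fin.snoc_last]
    | cast j =>
      rw [Fin.snoc_castSucc, Fin.succ_castSucc, Fin.snoc_castSucc]
      exact σ.tgt_arrow j

variable (σ : GPath 𝒢) {g : G} {γ : ℝ → M} (hγ : IsPiecewiseSmooth n γ)
  (hs : 𝒢.src g = σ.finish) (ht : 𝒢.tgt g = γ 0)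

@[simp]
theorem start_snoc : (σ.snoc g γ hγ hs ht).start = σ.start := by
  change Fin.snoc (α := fun _ => ℝ → M) σ.path γ (Fin.castSucc 0) 0 = σ.path 0 0
  rw [Fin.snoc_castSucc]

@[simp]
theorem finish_snoc : (σ.snoc g γ hγ hs ht).finish = γ 1 := by
  change Fin.snoc (α := fun _ => ℝ → M) σ.path γ (Fin.last _) 1 = γ 1
  rw [Fin.snoc_last]

variable [IsManifold (𝓡 n) ∞ M]

@[simp]
theorem gPathIntegral_snoc (θ : OneForm n M) :
    θ.gPathIntegral (σ.snoc g γ hγ hs ht) = θ.gPathIntegral σ + θ.pathIntegral γ := by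
  change ∑ k : Fin (σ.order + 1 + 1),
    θ.pathIntegral (Fin.snoc (α := fun _ => ℝ → M) σ.path γ k) = _
  rw [Fin.sum_univ_castSucc]
  simp only [Fin.snoc_castSucc, Fin.snoc_last]
  rfl

/-- `G`-paths can be concatenated. -/
theorem exists_concat (θ : OneForm n M) (σ ρ : GPath 𝒢) (h : ρ.start = σ.finish) :
    ∃ τ : GPath 𝒢, τ.start = σ.start ∧ τ.finish = ρ.finish ∧
      θ.gPathIntegral τ = θ.gPathIntegral σ + θ.gPathIntegral ρ := by
  -- Append the pieces of `ρ` one at a time; the first is joined to `σ` by a unit arrow.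
  suffices H : ∀ j : Fin (ρ.order + 1), ∃ τ : GPath 𝒢, τ.start = σ.start ∧
      τ.finish = ρ.path j 1 ∧
      θ.gPathIntegral τ = θ.gPathIntegral σ + ∑ i ∈ Finset.Iic j, θ.pathIntegral (ρ.path i) by
    obtain ⟨τ, h1, h2, h3⟩ := H (Fin.last _)
    refine ⟨τ, h1, h2, ?_⟩
    rw [h3]
    congr 2
    ext i
    simp [Fin.le_last]
  intro j
  induction j using Fin.induction with
  | zero =>
    refine ⟨σ.snoc (𝒢.one σ.finish) (ρ.path 0) (ρ.piecewiseSmooth 0) (𝒢.src_one _)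
      ((𝒢.tgt_one _).trans h.symm), by simp, by simp, ?_⟩
    have : Finset.Iic (0 : Fin (ρ.order + 1)) = {0} := by
      ext i
      simp
    simp [this]
  | succ j ih =>
    obtain ⟨τ, h1, h2, h3⟩ := ih
    refine ⟨τ.snoc (ρ.arrow j) (ρ.path j.succ) (ρ.piecewiseSmooth _)
      ((ρ.src_arrow j).trans h2.symm) (ρ.tgt_arrow j), by simp [h1], by simp, ?_⟩
    have : Finset.Iic j.succ = insert j.succ (Finset.Iic j.castSucc) := by
      ext i
      simp only [Finset.mem_Iic, Finset.mem_insert, Fin.le_def, Fin.ext_iff, Fin.val_succ,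
        Fin.val_castSucc]
      omega
    rw [gPathIntegral_snoc, h3, this, Finset.sum_insert (by simp [Fin.le_def])]
    ring

end GPath

/-! ### Integral periods and the primitive modulo integers -/

variable [IsManifold (𝓡 n) ∞ M]

/-- If the class of `θ` is integral, the integrals of `θ` along two `G`-paths with the same ends
differ by an integer. -/
theorem exists_gPathIntegral_eq_add_int {θ : ClosedBasicOneForm 𝒢}
    (hint : (basicClass θ).IsIntegral) (hconn : 𝒢.IsGConnected) {σ τ : GPath 𝒢}
    (hs : σ.start = τ.start) (hf : σ.finish = τ.finish) :
    ∃ k : ℤ, θ.1.gPathIntegral σ = θ.1.gPathIntegral τ + k := by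
  -- The same return path closes both `σ` and `τ`, so its contribution cancels in the difference of
  -- the two periods.
  obtain ⟨ρ, hρs, hρf⟩ := hconn σ.finish σ.start
  obtain ⟨σ', h1, h2, h3⟩ := GPath.exists_concat θ.1 σ ρ hρs
  obtain ⟨τ', h4, h5, h6⟩ := GPath.exists_concat θ.1 τ ρ (hρs.trans hf)
  obtain ⟨a, ha⟩ := hint σ.start ⟨σ', h1, h2.trans hρf⟩
  obtain ⟨b, hb⟩ := hint σ.start ⟨τ', h4.trans hs.symm, h5.trans hρf⟩
  change θ.1.gPathIntegral σ' = a at ha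
  change θ.1.gPathIntegral τ' = b at hb
  refine ⟨a - b, ?_⟩
  push_cast
  linarith

theorem OneForm.pathIntegral_const (θ : OneForm n M) (x : M) :
    θ.pathIntegral (fun _ => x) = 0 := by
  have : ∀ t, θ.pathIntegrand (fun _ => x) t = 0 := fun t => by
    rw [OneForm.pathIntegrand, mfderiv_const]
    exact map_zero (θ.toFun x)
  simp [OneForm.pathIntegral, this]

/-- A closed basic 1-form with integral class is the differential of a function with values in
`ℝ / ℤ` that is invariant under arrows. The latter is represented by a real function `φ`, which is
locally, up to integers, a smooth primitive whose critical values form a null set. -/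
theorem ClosedBasicOneForm.exists_primitive_mod_int [Nonempty M] (hconn : 𝒢.IsGConnected)
    (θ : ClosedBasicOneForm 𝒢) (hint : (basicClass θ).IsIntegral) :
    ∃ φ : M → ℝ, (∀ g, ∃ k : ℤ, φ (𝒢.tgt g) = φ (𝒢.src g) + k) ∧
      ∀ x₀ : M, ∃ W : Set M, IsOpen W ∧ x₀ ∈ W ∧ ∃ H : M → ℝ,
        ContMDiffOn (𝓡 n) 𝓘(ℝ, ℝ) ∞ H W ∧ (∀ x ∈ W, θ.1.toFun x = dFun n H x) ∧
        (∀ x ∈ W, ∃ k : ℤ, φ x = H x + k) ∧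
        MeasureTheory.volume (H '' {x ∈ W | θ.1.toFun x = 0}) = 0 := by
  obtain ⟨b⟩ := ‹Nonempty M›
  choose σ hσs hσf using hconn b
  refine ⟨fun x => θ.1.gPathIntegral (σ x), fun g => ?_, fun x₀ => ?_⟩
  -- A $G$-path must end with a path, so the arrow `g` is followed by a constant one, which
  -- contributes nothing.
  · obtain ⟨k, hk⟩ := exists_gPathIntegral_eq_add_int hint hconn (σ := σ (𝒢.tgt g))
      (τ := (σ (𝒢.src g)).snoc g (fun _ => 𝒢.tgt g) (isPiecewiseSmooth_const _)
        (hσf _).symm rfl) (by simp [hσs]) (by simp [hσf])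
    refine ⟨k, hk.trans ?_⟩
    rw [GPath.gPathIntegral_snoc, OneForm.pathIntegral_const, add_zero]
  · obtain ⟨W, hW, hx₀, H, hH, hd, hγ, h0⟩ := θ.2.2.exists_local_primitive x₀
    -- With this shift the local primitive takes at `x₀` the value of the global function;
    -- translation preserves null sets.
    let c := θ.1.gPathIntegral (σ x₀) - H x₀
    refine ⟨W, hW, hx₀, fun x => H x + c, hH.add contMDiffOn_const, fun x hx => ?_,
      fun x hx => ?_, ?_⟩
    · rw [hd x hx, dFun_add_const
        ((hH.contMDiffAt (hW.mem_nhds hx)).mdifferentiableAt (by simp))]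
    · obtain ⟨γ, hγs, hγ0, hγ1, hγi⟩ := hγ x hx
      obtain ⟨k, hk⟩ := exists_gPathIntegral_eq_add_int hint hconn (σ := σ x)
        (τ := (σ x₀).snoc (𝒢.one x₀) γ hγs ((𝒢.src_one _).trans (hσf _).symm)
          ((𝒢.tgt_one _).trans hγ0.symm)) (by simp [hσs]) (by simp [hσf, hγ1])
      refine ⟨k, hk.trans ?_⟩
      rw [GPath.gPathIntegral_snoc, hγi]
      ring
    · have : (fun x => H x + c) '' {x ∈ W | θ.1.toFun x = 0} =
          (fun r => r + c) '' (H '' {x ∈ W | θ.1.toFun x = 0}) := by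
        rw [image_image]
      rw [this, Set.image_add_right, MeasureTheory.measure_preimage_add_right, h0]

end GPathOperations

/-! ### Cutting the circle at a regular value -/

section Main

open MeasureTheory Topology

variable {n : ℕ} {M : Type*} [TopologicalSpace M] [ChartedSpace (EuclideanSpace ℝ (Fin n)) M]
  [IsManifold (𝓡 n) ∞ M]

/-- If `φ` is locally, up to integers, a function whose values at the zeros of `θ` form a null set,
then some value is avoided, modulo integers, by `φ` at the zeros of `θ`. -/
theorem OneForm.exists_forall_toIcoMod_ne [SecondCountableTopology M] (θ : OneForm n M) {φ : M → ℝ}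
    (hφ : ∀ x₀ : M, ∃ W : Set M, IsOpen W ∧ x₀ ∈ W ∧ ∃ H : M → ℝ,
      (∀ x ∈ W, ∃ k : ℤ, φ x = H x + k) ∧ volume (H '' {x ∈ W | θ.toFun x = 0}) = 0) :
    ∃ c : ℝ, ∀ x, θ.toFun x = 0 → toIcoMod one_pos c (φ x) ≠ c := by
  choose W hW hxW H hH h0 using hφ
  obtain ⟨t, -, htc, ht⟩ := TopologicalSpace.countable_cover_nhdsWithin (s := univ)
    (fun x _ => mem_nhdsWithin_of_mem_nhds ((hW x).mem_nhds (hxW x)))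
  -- All integer translates are included, so that avoiding `S` means avoiding the critical values
  -- modulo integers.
  let S : Set ℝ := ⋃ x ∈ t, ⋃ k : ℤ, (· + (k : ℝ)) '' (H x '' {y ∈ W x | θ.toFun y = 0})
  have hS : volume S = 0 := by
    refine (measure_biUnion_null_iff htc).2 fun x _ => measure_iUnion_null fun k => ?_
    rw [image_add_right, measure_preimage_add_right, h0]
  obtain ⟨c, hc⟩ : ∃ c, c ∉ S := by
    by_contra! h
    rw [eq_univ_of_forall h, Real.volume_univ] at hS
    exact ENNReal.top_ne_zero hS
  refine ⟨c, fun y hy h => hc ?_⟩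
  obtain ⟨x, hx, hyx⟩ := mem_iUnion₂.1 (ht (mem_univ y))
  obtain ⟨-, z, hz⟩ := (toIcoMod_eq_iff one_pos).1 h
  obtain ⟨k, hk⟩ := hH x y hyx
  refine mem_iUnion₂.2 ⟨x, hx, mem_iUnion.2 ⟨k - z, H x y, ⟨y, ⟨hyx, hy⟩, rfl⟩, ?_⟩⟩
  rw [zsmul_one] at hz
  push_cast
  linarith

/-- Where its value is not `c`, the representative in `[c, c + 1)` of a function that is smooth up to
locally constant integers is locally this smooth function, up to an integer. -/
theorem eventually_toIcoMod_eq {X : Type*} [TopologicalSpace X] {φ H : X → ℝ} {x : X} {c : ℝ}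
    (hH : ContinuousAt H x)
    (h : ∀ᶠ y in 𝓝 x, ∃ k : ℤ, φ y = H y + k) (hx : toIcoMod one_pos c (φ x) ≠ c) :
    ∃ k : ℤ, ∀ᶠ y in 𝓝 x, toIcoMod one_pos c (φ y) = H y + k ∧
      toIcoMod one_pos c (φ y) ≠ c := by
  obtain ⟨hIco, z, hz⟩ := (toIcoMod_eq_iff (one_pos (α := ℝ)) (a := c) (b := φ x)).1 rfl
  obtain ⟨k, hk⟩ := h.self_of_nhds
  rw [zsmul_one] at hz
  refine ⟨k - z, ?_⟩
  have hval : H x + ((k - z : ℤ) : ℝ) = toIcoMod one_pos c (φ x) := by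
    push_cast
    linarith
  -- The value `c`, where `toIcoMod` jumps, is excluded at `x`; hence the value lies in the open
  -- interval and nearby values stay there.
  have hIoo : ∀ᶠ y in 𝓝 x, H y + ((k - z : ℤ) : ℝ) ∈ Ioo c (c + 1) := by
    refine (hH.add continuousAt_const).eventually_mem (isOpen_Ioo.mem_nhds ?_)
    change H x + ((k - z : ℤ) : ℝ) ∈ Ioo c (c + 1)
    rw [hval]
    exact ⟨hIco.1.lt_of_ne' hx, hIco.2⟩
  filter_upwards [hIoo, h] with y hy ⟨j, hj⟩
  have : toIcoMod one_pos c (φ y) = H y + ((k - z : ℤ) : ℝ) := by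
    refine (toIcoMod_eq_iff one_pos).2 ⟨Ioo_subset_Ico_self hy, j - (k - z), ?_⟩
    rw [zsmul_one, hj]
    push_cast
    ring
  exact ⟨this, this ▸ hy.1.ne'⟩

end Main

theorem mainTheorem4 {n m : ℕ} {M G : Type*}
    [TopologicalSpace M] [T2Space M] [SecondCountableTopology M]
    [ChartedSpace (EuclideanSpace ℝ (Fin n)) M] [IsManifold (𝓡 n) ∞ M]
    [TopologicalSpace G] [T2Space G] [SecondCountableTopology G]
    [ChartedSpace (EuclideanSpace ℝ (Fin m)) G] [IsManifold (𝓡 m) ∞ G]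
    (𝒢 : LieGroupoid n m M G) (hproper : 𝒢.IsProper) (hetale : 𝒢.IsEtale)
    (hconn : 𝒢.IsGConnected)
    (Y : Set 𝒢.OrbitSpace) (hY : IsClosed Y)
    (θ : ClosedBasicOneForm 𝒢) (hint : (basicClass θ).IsIntegral) :
    θ.IsExactNear Y ↔ θ.1.VanishesOn (𝒢.proj ⁻¹' Y) := by
  constructor
  · rintro ⟨V, -, hYV, f, -, hd, h0⟩ x hx
    rw [hd x (hYV hx), h0 x hx]
  intro hvan
  -- Integration along $G$-paths needs a base point.
  rcases isEmpty_or_nonempty M with hM | hM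
  · exact ⟨univ, isOpen_univ, subset_univ _, fun _ => 0, contMDiffOn_const,
      fun x => hM.elim x, fun x => hM.elim x⟩
  obtain ⟨φ, hφ, hloc⟩ := θ.exists_primitive_mod_int hconn hint
  obtain ⟨c, hc⟩ := θ.1.exists_forall_toIcoMod_ne (φ := φ) fun x₀ => by
    obtain ⟨W, hW, hx, H, -, -, hk, h0⟩ := hloc x₀
    exact ⟨W, hW, hx, H, hk, h0⟩
  -- Arrows change `φ` by integers only, which `toIcoMod` does not see. The function may jump where
  -- it equals `c`; those orbits are left out of the neighbourhood below.
  let f : 𝒢.OrbitSpace → ℝ := Quotient.lift (s := 𝒢.orbitSetoid)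
    (fun x => toIcoMod one_pos c (φ x)) (by
      rintro _ _ ⟨g, rfl, rfl⟩
      obtain ⟨k, hk⟩ := hφ g
      exact (toIcoMod_eq_toIcoMod one_pos).2 ⟨k, by rw [hk]; simp⟩)
  have hf : ∀ x, f (𝒢.proj x) = toIcoMod one_pos c (φ x) := fun _ => rfl
  have key : ∀ x, f (𝒢.proj x) ≠ c → (∀ᶠ y in nhds x, f (𝒢.proj y) ≠ c) ∧
      ContMDiffAt (𝓡 n) 𝓘(ℝ, ℝ) ∞ (fun y => f (𝒢.proj y)) x ∧
      θ.1.toFun x = dFun n (fun y => f (𝒢.proj y)) x := by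
    intro x hx
    obtain ⟨W, hW, hxW, H, hH, hd, hk, -⟩ := hloc x
    have hWx := hW.mem_nhds hxW
    have hHx := hH.contMDiffAt hWx
    obtain ⟨k, hev⟩ := eventually_toIcoMod_eq hHx.continuousAt
      (Filter.mem_of_superset hWx hk) hx
    have heq : (fun y => f (𝒢.proj y)) =ᶠ[nhds x] fun y => H y + k := hev.mono fun y hy => hy.1
    refine ⟨hev.mono fun y hy => hy.2, (hHx.add contMDiffAt_const).congr_of_eventuallyEq heq, ?_⟩
    rw [hd x hxW, ← dFun_add_const (hHx.mdifferentiableAt (by simp)) (k : ℝ)]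
    exact heq.mfderiv_eq.symm
  -- This is where the vanishing of `θ` over `Y` enters: `c` was chosen to be avoided at every zero
  -- of `θ`.
  have hYc : ∀ x ∈ 𝒢.proj ⁻¹' Y, f (𝒢.proj x) ≠ c := fun x hx => hc x (hvan x hx)
  refine ⟨{q | f q ≠ c}, ?_, ?_, f, fun x hx => (key x hx).2.1.contMDiffWithinAt,
    fun x hx => (key x hx).2.2, fun x hx => ?_⟩
  · refine isOpen_coinduced.2 (isOpen_iff_mem_nhds.2 fun x hx => (key x hx).1)
  · intro q
    induction q using Quotient.inductionOn with
    | h x => exact hYc x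
  · rw [← (key x (hYc x hx)).2.2, hvan x hx]
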